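/- Theorem (Max-interconnection stability), \label{thm:GAS-max-interconnected}: Let $\mathcal{G}=(V,\mathcal{E})$ be a directed graph without self-loops on $V=\{1,\dots,n\}$, and for $i\in V$ let $\mathcal{N}_i=\{j\in V : (j,i)\in\mathcal{E}\}$. Let $f_i:\mathbb{R}\times\mathbb{R}^{\mathcal{N}_i}\to\mathbb{R}$, $i\in V$, be continuously differentiable, let $f:\mathbb{R}^n\to\mathbb{R}^n$ be given by $f(x)_i=f_i(x_i,x_{\mathcal{N}_i})$, where $x_{\mathcal{N}_i}=(x_j)_{j\in\mathcal{N}_i}$, and let $J(x)=\big(\partial f(x)_i/\partial x_j\big)_{i,j}$ be its Jacobian matrix. Consider the interconnected system \[ \dot x_i=f_i(x_i,x_{\mathcal{N}_i}),\qquad i\in\{1,\dots,n\}, \] on the nonnegative orthant $\mathbb{R}^n_{\ge 0}$. Assume that $f(0)=0$ and that for every $x\in\mathbb{R}^n_{\ge 0}$ the matrix $J(x)$ is Metzler (all off-diagonal entries are nonnegative) with negative diagonal entries. Assume moreover that there are positive numbers $\psi_{ij}$, for $i\in V$ and $j\in\mathcal{N}_i$, such that (i) for every $i\in\{1,\dots,n\}$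 and every $x\in\mathbb{R}^n_{\ge 0}$, \[ \sum_{j\in\mathcal{N}_i}\frac{J_{ij}(x)}{-J_{ii}(x)}\,\psi_{ij}^{-1}<1; \] (ii) for every simple cycle $(i_1,\dots,i_k,i_1)$ of $\mathcal{G}$ (that is, $k\ge 2$, the nodes $i_1,\dots,i_k$ are distinct, and $(i_1,i_2),\dots,(i_{k-1},i_k),(i_k,i_1)\in\mathcal{E}$), \[ \psi_{i_2i_1}\psi_{i_3i_2}\cdots\psi_{i_1i_k}<1. \] Then the origin is globally asymptotically stable for the system on $\mathbb{R}^n_{\ge 0}$: every initial state $x(0)\in\mathbb{R}^n_{\ge 0}$ has a unique solution $x(t)$ defined for all $t\ge 0$, and it remains in $\mathbb{R}^n_{\ge 0}$; for every $\varepsilon>0$ there is $\delta>0$ such that $x(0)\in\mathbb{R}^n_{\ge 0}$ and $|x(0)|<\delta$ imply $|x(t)|<\varepsilon$ for all $t\ge 0$; and $x(t)\to 0$ as $t\to\infty$ for every $x(0)\in\mathbb{R}^n_{\ge 0}$. -/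

import Mathlib

open Set Filter Topology

namespace MonotoneNetwork

/-- The neighbor set `N_i = {j | (j, i) is an edge}` of node `i` in a directed graph on
`{1, …, n}`; the edge `(j, i)` is `G.Adj j i`. -/
noncomputable def nbrs {n : ℕ} (G : Digraph (Fin n)) (i : Fin n) : Finset (Fin n) := by
  classical exact Finset.univ.filter (fun j => G.Adj j i)

/-- A simple cycle `(i_1, …, i_m, i_1)` with `m = k + 2 ≥ 2` distinct nodes (self loops are not
simple cycles). Addition in `Fin (k + 2)` is cyclic, so the last node has an edge to the first. -/
structure SimpleCycle {n : ℕ} (G : Digraph (Fin n)) where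
  k : ℕ
  node : Fin (k + 2) → Fin n
  injective : Function.Injective node
  adj : ∀ m, G.Adj (node m) (node (m + 1))

/-- The product `ψ_{i_2 i_1} ψ_{i_3 i_2} ⋯ ψ_{i_1 i_m}` along the cycle `(i_1, …, i_m, i_1)`. -/
def SimpleCycle.gain {n : ℕ} {G : Digraph (Fin n)} (c : SimpleCycle G)
    (ψ : Fin n → Fin n → ℝ) : ℝ :=
  ∏ m, ψ (c.node (m + 1)) (c.node m)

/-- The vector field on `ℝⁿ` of the interconnected system `ẋ_i = f_i (x_i, x_{N_i})`. -/
def field {n : ℕ} {G : Digraph (Fin n)} (f : ∀ i : Fin n, ℝ × (nbrs G i → ℝ) → ℝ)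
    (x : Fin n → ℝ) : Fin n → ℝ :=
  fun i => f i (x i, fun j => x j)

/-- The Jacobian matrix `J_{ij}(x) = ∂F_i / ∂x_j (x)`. -/
noncomputable def jacobian {n : ℕ} (F : (Fin n → ℝ) → (Fin n → ℝ)) (x : Fin n → ℝ) :
    Matrix (Fin n) (Fin n) ℝ :=
  LinearMap.toMatrix' (fderiv ℝ F x : (Fin n → ℝ) →ₗ[ℝ] (Fin n → ℝ))

/-- A matrix is Metzler if its off-diagonal entries are nonnegative. -/
def IsMetzler {n : ℕ} (M : Matrix (Fin n) (Fin n) ℝ) : Prop :=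
  ∀ i j, i ≠ j → 0 ≤ M i j

/-- The (closed) orthant of nonnegative vectors of `ℝⁿ`. -/
def orthant (n : ℕ) : Set (Fin n → ℝ) := {x | ∀ i, 0 ≤ x i}

/-- `x` is a solution of `ẋ = F(x)` on the time interval `[0, ∞)` with `x(0) = x₀`. -/
def IsSolution {n : ℕ} (F : (Fin n → ℝ) → (Fin n → ℝ)) (x₀ : Fin n → ℝ)
    (x : ℝ → (Fin n → ℝ)) : Prop :=
  x 0 = x₀ ∧ ∀ t, 0 ≤ t → HasDerivWithinAt x (F (x t)) (Ici 0) t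

/-- The point `p` is globally asymptotically stable for `ẋ = F(x)` on the state space `S`:
`p` is an equilibrium in `S`; every initial state in `S` has a solution defined for all `t ≥ 0`,
and solutions starting in `S` are unique and remain in `S`; `p` is Lyapunov stable; and every
solution starting in `S` converges to `p`. -/
structure IsGloballyAsymptoticallyStable {n : ℕ} (F : (Fin n → ℝ) → (Fin n → ℝ))
    (S : Set (Fin n → ℝ)) (p : Fin n → ℝ) : Prop where
  mem : p ∈ S
  equilibrium : F p = 0
  exists_solution : ∀ x₀ ∈ S, ∃ x, IsSolution F x₀ x
  unique : ∀ x₀ ∈ S, ∀ x y, IsSolution F x₀ x → IsSolution F x₀ y → EqOn x y (Ici 0)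
  invariant : ∀ x₀ ∈ S, ∀ x, IsSolution F x₀ x → ∀ t, 0 ≤ t → x t ∈ S
  stable : ∀ U ∈ 𝓝 p, ∃ W ∈ 𝓝 p, ∀ x₀ ∈ W ∩ S, ∀ x, IsSolution F x₀ x → ∀ t, 0 ≤ t → x t ∈ U
  attractive : ∀ x₀ ∈ S, ∀ x, IsSolution F x₀ x → Tendsto x atTop (𝓝 p)

end MonotoneNetwork

open scoped NNReal

/-! The cycle condition yields a positive vector `p` with `ψ i j * p j ≤ p i` on every edge: `p i`
is the supremum of the weights of the simple paths ending at `i` (`mul_potential_le`). Inserted into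
the row sums, this gives `(J(x) p)_i < 0` on the whole orthant (`fderiv_field_neg`).

On the compact box `[0, c p]` this becomes `J(x) p ≤ -η p` for some `η > 0`. The mean value theorem
on the segment from `0`, where the field vanishes, and the Metzler property then show that the boxes
`[0, c e^{-ηt} p]` trap solutions (`exists_isSolution_decaying`). These boxes exhaust the orthant as
`c` grows and shrink to `0` in time, so existence, invariance, stability and attraction follow, with
uniqueness from local Lipschitz continuity. -/

namespace MonotoneNetwork

/-! ### Potentials for weighted digraphs -/

section Potential

variable {n : ℕ} {G : Digraph (Fin n)} {ψ : Fin n → Fin n → ℝ}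

/-- `u 0, …, u m` is a simple path of `G` that ends at `i`. -/
structure IsSimplePath (G : Digraph (Fin n)) (m : ℕ) (u : ℕ → Fin n) (i : Fin n) : Prop where
  injOn : InjOn u (Iic m)
  adj : ∀ a < m, G.Adj (u a) (u (a + 1))
  last : u m = i

/-- The product of the weights of the edges of the path `u 0, …, u m`. -/
def pathWeight (ψ : Fin n → Fin n → ℝ) (m : ℕ) (u : ℕ → Fin n) : ℝ :=
  ∏ a ∈ Finset.range m, ψ (u (a + 1)) (u a)

/-- The weights of the simple paths that end at `i`. -/
def pathWeights (G : Digraph (Fin n)) (ψ : Fin n → Fin n → ℝ) (i : Fin n) : Set ℝ :=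
  {w | ∃ m u, IsSimplePath G m u i ∧ w = pathWeight ψ m u}

/-- The supremum of the weights of the simple paths that end at `i`. -/
noncomputable def potential (G : Digraph (Fin n)) (ψ : Fin n → Fin n → ℝ) (i : Fin n) : ℝ :=
  sSup (pathWeights G ψ i)

lemma IsSimplePath.lt {m : ℕ} {u : ℕ → Fin n} {i : Fin n} (h : IsSimplePath G m u i) :
    m < n := by
  have h1 : Function.Injective (fun a : Fin (m + 1) => u a) := fun a b hab =>
    Fin.ext (h.injOn (Nat.lt_succ_iff.1 a.2) (Nat.lt_succ_iff.1 b.2) hab)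
  simpa [Nat.succ_le_iff] using Fintype.card_le_of_injective _ h1

lemma bddAbove_pathWeights (hψ : ∀ i j, G.Adj j i → 0 < ψ i j) (i : Fin n) :
    BddAbove (pathWeights G ψ i) := by
  obtain ⟨M, hM⟩ := (Set.finite_range (fun q : Fin n × Fin n => ψ q.1 q.2)).bddAbove
  -- Simple paths have fewer than `n` edges; a base at least `1` makes the bound monotone in their
  -- length.
  refine ⟨(max 1 M) ^ n, ?_⟩
  rintro _ ⟨m, u, h, rfl⟩
  calc pathWeight ψ m u ≤ ∏ _a ∈ Finset.range m, max 1 M :=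
        Finset.prod_le_prod (fun a ha => (hψ _ _ (h.adj a (Finset.mem_range.1 ha))).le)
          fun a _ => (hM ⟨(u (a + 1), u a), rfl⟩).trans (le_max_right _ _)
    _ = (max 1 M) ^ m := by simp
    _ ≤ (max 1 M) ^ n := pow_le_pow_right₀ (le_max_left _ _) h.lt.le

lemma one_mem_pathWeights (i : Fin n) : 1 ∈ pathWeights G ψ i :=
  ⟨0, fun _ => i, ⟨fun a ha b hb _ => (Nat.le_zero.1 ha).trans (Nat.le_zero.1 hb).symm,
    fun a ha => absurd ha a.not_lt_zero, rfl⟩, by simp [pathWeight]⟩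

lemma potential_pos (hψ : ∀ i j, G.Adj j i → 0 < ψ i j) (i : Fin n) : 0 < potential G ψ i :=
  one_pos.trans_le (le_csSup (bddAbove_pathWeights hψ i) (one_mem_pathWeights i))

/-- The edge from `j` to `i` closes the tail `u b, …, u m` into a simple cycle; deleting this cycle,
of gain below `1`, leaves the initial segment up to `b`. -/
lemma mul_pathWeight_le_of_mem (hG : ∀ i, ¬ G.Adj i i) (hψ : ∀ i j, G.Adj j i → 0 < ψ i j)
    (hcycle : ∀ c : SimpleCycle G, c.gain ψ < 1) {i j : Fin n} (hij : G.Adj j i)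
    {m : ℕ} {u : ℕ → Fin n} (h : IsSimplePath G m u j) {b : ℕ} (hb : b ≤ m) (hbi : u b = i) :
    ψ i j * pathWeight ψ m u ≤ pathWeight ψ b u := by
  -- Without self-loops the cycle has at least two nodes, as `SimpleCycle` demands.
  have hbm : b ≠ m := by
    rintro rfl
    exact hG i (by rwa [← h.last, hbi] at hij)
  obtain ⟨k, rfl⟩ : ∃ k, m = b + (k + 1) := ⟨m - b - 1, by omega⟩
  have hlast : ∀ x : Fin (k + 2), x = Fin.last (k + 1) ∨ ∃ y : Fin (k + 1), x = y.castSucc :=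
    fun x => by
      induction x using Fin.lastCases with
      | last => exact Or.inl rfl
      | cast y => exact Or.inr ⟨y, rfl⟩
  let c : SimpleCycle G :=
    { k := k
      node := fun a => u (b + a)
      injective := fun x y hxy => by
        have h1 := h.injOn (show b + (x : ℕ) ≤ b + (k + 1) by omega)
          (show b + (y : ℕ) ≤ b + (k + 1) by omega) hxy
        exact Fin.ext (by omega)
      adj := fun x => by
        rcases hlast x with rfl | ⟨y, rfl⟩
        · simpa [h.last, hbi] using hij
        · have := h.adj (b + y) (by omega)
          simpa [Fin.coeSucc_eq_succ, add_assoc] using this }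
  have hc : c.gain ψ = (∏ a ∈ Finset.range (k + 1), ψ (u (b + a + 1)) (u (b + a))) * ψ i j := by
    have : c.gain ψ = ∏ x : Fin (k + 2), ψ (u (b + (x + 1 : Fin (k + 2)))) (u (b + x)) := rfl
    rw [this, Fin.prod_univ_castSucc, Finset.prod_range]
    congr 1
    · refine Finset.prod_congr rfl fun y _ => ?_
      simp [Fin.coeSucc_eq_succ, add_assoc]
    · simp [h.last, hbi]
  have hsplit : pathWeight ψ (b + (k + 1)) u = pathWeight ψ b u *
      ∏ a ∈ Finset.range (k + 1), ψ (u (b + a + 1)) (u (b + a)) :=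
    Finset.prod_range_add _ _ _
  have hpos : 0 < pathWeight ψ b u :=
    Finset.prod_pos fun a ha => hψ _ _ (h.adj a (by have := Finset.mem_range.1 ha; omega))
  calc ψ i j * pathWeight ψ (b + (k + 1)) u = pathWeight ψ b u * c.gain ψ := by
        rw [hsplit, hc]; ring
    _ ≤ pathWeight ψ b u * 1 := mul_le_mul_of_nonneg_left (hcycle c).le hpos.le
    _ = _ := mul_one _

lemma mul_potential_le (hG : ∀ i, ¬ G.Adj i i) (hψ : ∀ i j, G.Adj j i → 0 < ψ i j)
    (hcycle : ∀ c : SimpleCycle G, c.gain ψ < 1) {i j : Fin n} (hij : G.Adj j i) :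
    ψ i j * potential G ψ j ≤ potential G ψ i := by
  rw [mul_comm, ← le_div_iff₀ (hψ i j hij)]
  refine csSup_le ⟨1, one_mem_pathWeights j⟩ ?_
  rintro _ ⟨m, u, h, rfl⟩
  rw [le_div_iff₀ (hψ i j hij), mul_comm]
  by_cases hi : ∃ b ≤ m, u b = i
  · obtain ⟨b, hb, hbi⟩ := hi
    refine (mul_pathWeight_le_of_mem hG hψ hcycle hij h hb hbi).trans
      (le_csSup (bddAbove_pathWeights hψ i) ⟨b, u, ⟨h.injOn.mono (Iic_subset_Iic.2 hb),
        fun a ha => h.adj a (ha.trans_le hb), hbi⟩, rfl⟩)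
  -- Here `i` is a new node, so appending it keeps the path simple.
  · push Not at hi
    have hu : ∀ a ≤ m, Function.update u (m + 1) i a = u a := fun a ha =>
      Function.update_of_ne (by omega) _ _
    refine le_csSup (bddAbove_pathWeights hψ i)
      ⟨m + 1, Function.update u (m + 1) i, ⟨?_, ?_, by simp⟩, ?_⟩
    · intro a ha b hb hab
      rcases Nat.le_succ_iff.1 ha with ha | rfl <;> rcases Nat.le_succ_iff.1 hb with hb | rfl
      · exact h.injOn ha hb (by rwa [hu a ha, hu b hb] at hab)
      · exact absurd (by simpa [hu a ha] using hab) (hi a ha)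
      · exact absurd (by simpa [hu b hb] using hab.symm) (hi b hb)
      · rfl
    · intro a ha
      rcases Nat.lt_succ_iff_lt_or_eq.1 ha with ha | rfl
      · rw [hu a ha.le, hu (a + 1) ha]
        exact h.adj a ha
      · rw [hu a le_rfl, Function.update_self, h.last]
        exact hij
    · rw [pathWeight, pathWeight, Finset.prod_range_succ, Function.update_self, hu m le_rfl, h.last, mul_comm]
      congr 1
      refine Finset.prod_congr rfl fun a ha => ?_
      have := Finset.mem_range.1 ha
      rw [hu a this.le, hu (a + 1) this]

end Potential

/-! ### Global solutions of time-dependent bounded Lipschitz systems -/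

section GlobalExistence

variable {E : Type*} [NormedAddCommGroup E] [NormedSpace ℝ E]

lemma exists_solution_Icc [CompleteSpace E] {v : ℝ → E → E} {K L : ℝ≥0}
    (hv : ∀ t, 0 ≤ t → LipschitzWith K (v t))
    (hc : ∀ x, Continuous fun t => v t x) (hL : ∀ t, 0 ≤ t → ∀ x, ‖v t x‖ ≤ L) (x₀ : E)
    {T : ℝ} (hT : 0 ≤ T) :
    ∃ α : ℝ → E, α 0 = x₀ ∧ ∀ t ∈ Icc 0 T, HasDerivWithinAt α (v t (α t)) (Icc 0 T) t := by
  -- With a global bound `L` on the speed, the radius `L * T` leaves room for the whole interval.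
  have h : IsPicardLindelof v (⟨0, le_rfl, hT⟩ : Icc (0 : ℝ) T) x₀ (L * T.toNNReal) 0 L K :=
    { lipschitzOnWith := fun t ht => (hv t ht.1).lipschitzOnWith
      continuousOn := fun x _ => (hc x).continuousOn
      norm_le := fun t ht x _ => hL t ht.1 x
      mul_max_le := by simp [hT] }
  exact h.exists_eq_forall_mem_Icc_hasDerivWithinAt₀

lemma eqOn_Icc_of_lipschitz {v : ℝ → E → E} {K : ℝ≥0} {s : Set E} {T : ℝ}
    (hv : ∀ t, 0 ≤ t → LipschitzOnWith K (v t) s) {α β : ℝ → E}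
    (hα : ∀ t ∈ Icc 0 T, HasDerivWithinAt α (v t (α t)) (Icc 0 T) t)
    (hβ : ∀ t ∈ Icc 0 T, HasDerivWithinAt β (v t (β t)) (Icc 0 T) t)
    (hαs : ∀ t ∈ Icc 0 T, α t ∈ s) (hβs : ∀ t ∈ Icc 0 T, β t ∈ s)
    (h0 : α 0 = β 0) : EqOn α β (Icc 0 T) := by
  have hnhds : ∀ t ∈ Ico 0 T, Icc 0 T ∈ 𝓝[Ici t] t := fun t ht =>
    mem_of_superset (Icc_mem_nhdsGE ht.2) (Icc_subset_Icc_left ht.1)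
  exact ODE_solution_unique_of_mem_Icc_right (v := v) (s := fun _ => s) (K := K)
    (fun t ht => hv t ht.1)
    (fun t ht => (hα t ht).continuousWithinAt)
    (fun t ht => (hα t (Ico_subset_Icc_self ht)).mono_of_mem_nhdsWithin (hnhds t ht))
    (fun t ht => hαs t (Ico_subset_Icc_self ht))
    (fun t ht => (hβ t ht).continuousWithinAt)
    (fun t ht => (hβ t (Ico_subset_Icc_self ht)).mono_of_mem_nhdsWithin (hnhds t ht))
    (fun t ht => hβs t (Ico_subset_Icc_self ht)) h0

lemma exists_global_solution [CompleteSpace E] {v : ℝ → E → E} {K L : ℝ≥0}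
    (hv : ∀ t, 0 ≤ t → LipschitzWith K (v t))
    (hc : ∀ x, Continuous fun t => v t x) (hL : ∀ t, 0 ≤ t → ∀ x, ‖v t x‖ ≤ L) (x₀ : E) :
    ∃ α : ℝ → E, α 0 = x₀ ∧ ∀ t, 0 ≤ t → HasDerivWithinAt α (v t (α t)) (Ici 0) t := by
  choose α hα0 hα using fun N : ℕ => exists_solution_Icc hv hc hL x₀ (Nat.cast_nonneg (α := ℝ) N)
  have hmono : ∀ {M N : ℕ}, M ≤ N → EqOn (α M) (α N) (Icc 0 (M : ℝ)) := fun {M N} hMN => by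
    have hsub : Icc (0 : ℝ) M ⊆ Icc 0 N := Icc_subset_Icc_right (Nat.cast_le.2 hMN)
    exact eqOn_Icc_of_lipschitz (s := univ) (fun t ht => (hv t ht).lipschitzOnWith) (hα M)
      (fun t ht => (hα N t (hsub ht)).mono hsub) (fun _ _ => mem_univ _) (fun _ _ => mem_univ _)
      ((hα0 M).trans (hα0 N).symm)
  have key : ∀ (N : ℕ) (s : ℝ), 0 ≤ s → s < N → α (⌊s⌋₊ + 1) s = α N s := fun N s hs hsN =>
    hmono (Nat.succ_le_of_lt ((Nat.floor_lt hs).2 hsN))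
      ⟨hs, by exact_mod_cast (Nat.lt_floor_add_one s).le⟩
  -- The index `⌊s⌋₊ + 1` exceeds `s`; by uniqueness any larger index gives the same value.
  refine ⟨fun s => α (⌊s⌋₊ + 1) s, hα0 _, fun t ht => ?_⟩
  obtain ⟨N, hN⟩ := exists_nat_gt t
  have hnhds : Icc 0 (N : ℝ) ∈ 𝓝[Ici 0] t := by
    rw [← Ici_inter_Iic]
    exact inter_mem self_mem_nhdsWithin (mem_nhdsWithin_of_mem_nhds (Iic_mem_nhds hN))
  have h := (hα N t ⟨ht, hN.le⟩).mono_of_mem_nhdsWithin hnhds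
  simp only [key N t ht hN]
  refine h.congr_of_eventuallyEq ?_ (key N t ht hN)
  filter_upwards [self_mem_nhdsWithin, mem_nhdsWithin_of_mem_nhds (Iio_mem_nhds hN)] with s hs hsN
  exact key N s hs hsN

/-- A function that starts nonpositive and does not increase where it is positive stays
nonpositive. -/
lemma nonpos_of_deriv_nonpos {z z' : ℝ → ℝ} (h0 : z 0 ≤ 0)
    (hz : ∀ t, 0 ≤ t → HasDerivWithinAt z (z' t) (Ici 0) t)
    (hz' : ∀ t, 0 ≤ t → 0 < z t → z' t ≤ 0) {t : ℝ} (ht : 0 ≤ t) : z t ≤ 0 := by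
  -- Wherever `z` meets the barrier `ε (1 + s)` it is positive, so its slope is at most `0 < ε`.
  have key : ∀ ε > 0, z t ≤ ε * (1 + t) := fun ε hε => by
    refine image_le_of_deriv_right_lt_deriv_boundary (f := z) (f' := z') (a := 0) (b := t)
      (B := fun s => ε * (1 + s)) (B' := fun _ => ε)
      (fun s hs => (hz s hs.1).continuousWithinAt.mono Icc_subset_Ici_self)
      (fun s hs => (hz s hs.1).mono (Ici_subset_Ici.2 hs.1)) (by simpa using h0.trans hε.le)
      (fun s => by simpa using ((hasDerivAt_id s).const_add 1).const_mul ε)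
      (fun s hs h => (hz' s hs.1 ?_).trans_lt hε) ⟨ht, le_rfl⟩
    rw [h]
    exact mul_pos hε (by linarith [hs.1])
  refine le_of_forall_pos_le_add fun δ hδ => ?_
  have := key (δ / (1 + t)) (by positivity)
  rwa [div_mul_cancel₀ _ (by positivity), ← zero_add δ] at this

end GlobalExistence

/-! ### Cooperative systems with a strictly decreasing direction -/

section Cooperative

variable {n : ℕ} {F : (Fin n → ℝ) → (Fin n → ℝ)} {p : Fin n → ℝ}

lemma jacobian_apply (F : (Fin n → ℝ) → (Fin n → ℝ)) (x : Fin n → ℝ) (i j : Fin n) :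
    jacobian F x i j = fderiv ℝ F x (Pi.single j 1) i := by
  simp [jacobian, LinearMap.toMatrix'_apply]

lemma fderiv_apply_eq_sum (F : (Fin n → ℝ) → (Fin n → ℝ)) (x v : Fin n → ℝ) (i : Fin n) :
    fderiv ℝ F x v i = ∑ j, jacobian F x i j * v j :=
  (congrFun (LinearMap.toMatrix'_mulVec (fderiv ℝ F x : (Fin n → ℝ) →ₗ[ℝ] (Fin n → ℝ)) v) i).symm

/-- The diagonal entry, the only one that may be negative, multiplies equal coordinates. -/
lemma IsMetzler.fderiv_apply_le {x v w : Fin n → ℝ} (hM : IsMetzler (jacobian F x))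
    (hvw : v ≤ w) {i : Fin n} (hi : v i = w i) : fderiv ℝ F x v i ≤ fderiv ℝ F x w i := by
  rw [fderiv_apply_eq_sum, fderiv_apply_eq_sum]
  refine Finset.sum_le_sum fun j _ => ?_
  rcases eq_or_ne i j with rfl | hij
  · rw [hi]
  · exact mul_le_mul_of_nonneg_left (hvw j) (hM i j hij)

lemma exists_apply_eq_fderiv (hF : Differentiable ℝ F) (h0 : F 0 = 0) (x : Fin n → ℝ)
    (i : Fin n) : ∃ τ ∈ Ioo (0 : ℝ) 1, F x i = fderiv ℝ F (τ • x) x i := by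
  have h : ∀ s : ℝ, HasDerivAt (fun s : ℝ => F (s • x) i) (fderiv ℝ F (s • x) x i) s := fun s => by
    have h1 : HasDerivAt (fun s : ℝ => s • x) x s := by
      simpa using (hasDerivAt_id s).smul_const x
    exact hasDerivAt_pi.1 ((hF (s • x)).hasFDerivAt.comp_hasDerivAt s h1) i
  obtain ⟨τ, hτ, hs⟩ := exists_hasDerivAt_eq_slope _ _ one_pos
    (fun s _ => (h s).continuousAt.continuousWithinAt) fun s _ => h s
  exact ⟨τ, hτ, by simpa [h0] using hs.symm⟩

lemma apply_nonneg_of_eq_zero (hF : Differentiable ℝ F) (h0 : F 0 = 0)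
    (hM : ∀ x ∈ orthant n, IsMetzler (jacobian F x)) {x : Fin n → ℝ} (hx : x ∈ orthant n)
    {i : Fin n} (hi : x i = 0) : 0 ≤ F x i := by
  obtain ⟨τ, hτ, h⟩ := exists_apply_eq_fderiv hF h0 x i
  have hτx : τ • x ∈ orthant n := fun j => mul_nonneg hτ.1.le (hx j)
  simpa [h] using (hM _ hτx).fderiv_apply_le (v := 0) (w := x) hx (i := i) (by simp [hi])

lemma apply_le_of_eq (hF : Differentiable ℝ F) (h0 : F 0 = 0)
    (hM : ∀ x ∈ orthant n, IsMetzler (jacobian F x)) (hp : 0 ≤ p) {c η : ℝ}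
    (hη : ∀ x ∈ Icc 0 (c • p), ∀ i, fderiv ℝ F x p i ≤ -η * p i) {s : ℝ} (hs : 0 ≤ s)
    (hsc : s ≤ c) {x : Fin n → ℝ} (hx : x ∈ Icc 0 (s • p)) {i : Fin n} (hi : x i = s * p i) :
    F x i ≤ -η * (s * p i) := by
  obtain ⟨τ, hτ, h⟩ := exists_apply_eq_fderiv hF h0 x i
  have hτx : τ • x ∈ Icc 0 (c • p) := by
    refine ⟨fun j => mul_nonneg hτ.1.le (hx.1 j), fun j => ?_⟩
    calc τ * x j ≤ 1 * x j := mul_le_mul_of_nonneg_right hτ.2.le (hx.1 j)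
      _ ≤ s * p j := by simpa using hx.2 j
      _ ≤ c * p j := mul_le_mul_of_nonneg_right hsc (hp j)
  calc F x i = fderiv ℝ F (τ • x) x i := h
    _ ≤ fderiv ℝ F (τ • x) (s • p) i := (hM _ hτx.1).fderiv_apply_le hx.2 hi
    _ = s * fderiv ℝ F (τ • x) p i := by simp
    _ ≤ s * (-η * p i) := mul_le_mul_of_nonneg_left (hη _ hτx i) hs
    _ = _ := by ring

/-- Compactness makes the strict inequality uniform on the box; the rate depends on `c`. -/
lemma exists_rate (hF : ContDiff ℝ 1 F)
    (hneg : ∀ x ∈ orthant n, ∀ i, fderiv ℝ F x p i < 0) (c : ℝ) :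
    ∃ η > 0, ∀ x ∈ Icc 0 (c • p), ∀ i, fderiv ℝ F x p i ≤ -η * p i := by
  rcases (Icc 0 (c • p)).eq_empty_or_nonempty with he | hne
  · exact ⟨1, one_pos, by simp [he]⟩
  have key : ∀ i, ∀ᶠ η in 𝓝[>] (0 : ℝ), ∀ x ∈ Icc 0 (c • p), fderiv ℝ F x p i ≤ -η * p i := by
    intro i
    have hcont : Continuous fun x => fderiv ℝ F x p i :=
      (continuous_apply i).comp ((hF.continuous_fderiv one_ne_zero).clm_apply continuous_const)
    obtain ⟨y, hy, hmax⟩ := isCompact_Icc.exists_isMaxOn hne hcont.continuousOn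
    have hev : ∀ᶠ η in 𝓝[>] (0 : ℝ), fderiv ℝ F y p i < -η * p i := by
      have : Tendsto (fun η : ℝ => -η * p i) (𝓝[>] 0) (𝓝 0) := by
        have hc : Continuous fun η : ℝ => -η * p i := by fun_prop
        simpa using (hc.tendsto 0).mono_left nhdsWithin_le_nhds
      exact this.eventually (lt_mem_nhds (hneg y hy.1 i))
    filter_upwards [hev] with η hη x hx
    exact (hmax hx).trans hη.le
  obtain ⟨η, hη, hpos⟩ := ((eventually_all.2 key).and self_mem_nhdsWithin).exists
  exact ⟨η, hpos, fun x hx i => hη i x hx⟩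

/-- The coordinatewise projection to the box `[0, b]`. -/
def clamp (b x : Fin n → ℝ) : Fin n → ℝ := fun i => max 0 (min (x i) (b i))

lemma clamp_mem {b : Fin n → ℝ} (hb : 0 ≤ b) (x : Fin n → ℝ) : clamp b x ∈ Icc 0 b :=
  ⟨fun _ => le_max_left _ _, fun i => max_le (hb i) (min_le_right _ _)⟩

lemma clamp_of_mem {b x : Fin n → ℝ} (hx : x ∈ Icc 0 b) : clamp b x = x :=
  funext fun i => by
    rw [clamp, min_eq_left (hx.2 i)]
    exact max_eq_right (hx.1 i)

lemma lipschitzWith_clamp (b : Fin n → ℝ) : LipschitzWith 1 (clamp b) :=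
  LipschitzWith.of_dist_le_mul fun x y => (dist_pi_le_iff (by positivity)).2 fun i =>
    (((LipschitzWith.eval i).min_const (b i)).const_max 0).dist_le_mul x y

/-- Solutions that start in the box `[0, c p]` decay exponentially. -/
lemma exists_isSolution_decaying (hF : ContDiff ℝ 1 F) (h0 : F 0 = 0)
    (hM : ∀ x ∈ orthant n, IsMetzler (jacobian F x)) (hp : 0 ≤ p) {c η : ℝ} (hc : 0 ≤ c)
    (hη0 : 0 ≤ η) (hη : ∀ x ∈ Icc 0 (c • p), ∀ i, fderiv ℝ F x p i ≤ -η * p i)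
    {x₀ : Fin n → ℝ} (hx₀ : x₀ ∈ Icc 0 (c • p)) :
    ∃ x, IsSolution F x₀ x ∧ ∀ t, 0 ≤ t → x t ∈ Icc 0 ((c * Real.exp (-η * t)) • p) := by
  have hd := hF.differentiable one_ne_zero
  obtain ⟨K, hK⟩ := (hF.locallyLipschitz.locallyLipschitzOn (s := Icc 0 (c • p))
    ).exists_lipschitzOnWith_of_compact isCompact_Icc
  obtain ⟨L, hL⟩ := isCompact_Icc.exists_bound_of_continuousOn
    (hF.continuous.continuousOn (s := Icc 0 (c • p)))
  set r : ℝ → ℝ := fun t => c * Real.exp (-η * t) with hr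
  have hr0 : ∀ t, 0 ≤ r t := fun t => mul_nonneg hc (Real.exp_pos _).le
  have hrc : ∀ t, 0 ≤ t → r t ≤ c := fun t ht =>
    mul_le_of_le_one_right hc (Real.exp_le_one_iff.2 (by nlinarith))
  have hrd : ∀ t, HasDerivAt r (-η * r t) t := fun t => by
    have := ((hasDerivAt_id t).const_mul (-η)).exp.const_mul c
    refine this.congr_deriv ?_
    simp only [hr, id]
    ring
  have hmem : ∀ t x, clamp (r t • p) x ∈ Icc 0 (r t • p) := fun t x =>
    clamp_mem (smul_nonneg (hr0 t) hp) x
  have hmemc : ∀ t, 0 ≤ t → ∀ x, clamp (r t • p) x ∈ Icc 0 (c • p) := fun t ht x =>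
    ⟨(hmem t x).1, (hmem t x).2.trans (smul_le_smul_of_nonneg_right (hrc t ht) hp)⟩
  -- Clamping to the moving box makes the field bounded and globally Lipschitz. The solution will be
  -- shown never to leave the box, so it solves the original system.
  obtain ⟨x, hx0, hx⟩ := exists_global_solution (v := fun t x => F (clamp (r t • p) x))
    (K := K * 1) (L := L.toNNReal)
    (fun t ht => lipschitzOnWith_univ.1 (hK.comp ((lipschitzWith_clamp _).lipschitzOnWith)
      fun x _ => hmemc t ht x))
    (fun x => hF.continuous.comp (by unfold clamp; simp only [hr, Pi.smul_apply]; fun_prop))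
    (fun t ht x => (hL _ (hmemc t ht x)).trans (Real.le_coe_toNNReal L)) x₀
  have hxi : ∀ i t, 0 ≤ t →
      HasDerivWithinAt (fun t => x t i) (F (clamp (r t • p) (x t)) i) (Ici 0) t := fun i t ht =>
    hasDerivWithinAt_pi.1 (hx t ht) i
  have hbox : ∀ t, 0 ≤ t → x t ∈ Icc 0 (r t • p) := by
    refine fun t ht => ⟨fun i => ?_, fun i => ?_⟩
    · refine neg_nonpos.1 (nonpos_of_deriv_nonpos (z := fun t => -x t i) ?_
        (fun t ht => (hxi i t ht).neg) (fun t ht hpos => ?_) ht)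
      · simpa [hx0] using hx₀.1 i
      · refine neg_nonpos.2 (apply_nonneg_of_eq_zero hd h0 hM (hmem t (x t)).1 ?_)
        exact max_eq_left ((min_le_left _ _).trans (neg_pos.1 hpos).le)
    · refine sub_nonpos.1 (nonpos_of_deriv_nonpos (z := fun t => x t i - r t * p i) ?_
        (fun t ht => (hxi i t ht).sub ((hrd t).hasDerivWithinAt.mul_const (p i)))
        (fun t ht hpos => ?_) ht)
      · simpa [hx0, hr] using hx₀.2 i
      -- Above the upper face the clamp lands on it, where the field decreases at least as fast as
      -- the face, whose speed is `-η * r t * p i`.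
      · have hi : clamp (r t • p) (x t) i = r t * p i := by
          rw [clamp, Pi.smul_apply, smul_eq_mul, min_eq_right (sub_pos.1 hpos).le]
          exact max_eq_right (mul_nonneg (hr0 t) (hp i))
        have := apply_le_of_eq hd h0 hM hp hη (hr0 t) (hrc t ht) (hmem t (x t)) hi
        linarith
  refine ⟨x, ⟨hx0, fun t ht => ?_⟩, hbox⟩
  have := hx t ht
  simpa only [clamp_of_mem (hbox t ht)] using this

lemma IsSolution.continuousOn {x₀ : Fin n → ℝ} {x : ℝ → Fin n → ℝ} (hx : IsSolution F x₀ x) :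
    ContinuousOn x (Ici 0) :=
  fun t ht => (hx.2 t ht).continuousWithinAt

/-- Both trajectories on `[0, T]` stay in one closed ball, where `F` is Lipschitz. Hence the bounds
on the constructed solution hold for every solution. -/
lemma IsSolution.eqOn (hF : ContDiff ℝ 1 F) {x₀ : Fin n → ℝ} {x y : ℝ → Fin n → ℝ}
    (hx : IsSolution F x₀ x) (hy : IsSolution F x₀ y) : EqOn x y (Ici 0) := by
  intro T hT
  obtain ⟨R, hR⟩ := isCompact_Icc.exists_bound_of_continuousOn
    (hx.continuousOn.mono (Icc_subset_Ici_self (a := T) (b := 0)))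
  obtain ⟨S, hS⟩ := isCompact_Icc.exists_bound_of_continuousOn
    (hy.continuousOn.mono (Icc_subset_Ici_self (a := T) (b := 0)))
  obtain ⟨K, hK⟩ := (hF.locallyLipschitz.locallyLipschitzOn
    (s := Metric.closedBall 0 (max R S))).exists_lipschitzOnWith_of_compact
      (isCompact_closedBall _ _)
  exact eqOn_Icc_of_lipschitz (v := fun _ => F) (fun _ _ => hK)
    (fun t ht => (hx.2 t ht.1).mono Icc_subset_Ici_self)
    (fun t ht => (hy.2 t ht.1).mono Icc_subset_Ici_self)
    (fun t ht => mem_closedBall_zero_iff.2 ((hR t ht).trans (le_max_left _ _)))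
    (fun t ht => mem_closedBall_zero_iff.2 ((hS t ht).trans (le_max_right _ _)))
    (hx.1.trans hy.1.symm) ⟨hT, le_rfl⟩

lemma exists_le_smul (hp : ∀ i, 0 < p i) (x : Fin n → ℝ) : ∃ c : ℝ, 0 ≤ c ∧ x ≤ c • p := by
  obtain ⟨c, hc⟩ := (Set.finite_range fun i => x i / p i).bddAbove
  exact ⟨max 0 c, le_max_left _ _, fun i =>
    (div_le_iff₀ (hp i)).1 ((hc ⟨i, rfl⟩).trans (le_max_right _ _))⟩

lemma exists_Icc_smul_subset (p : Fin n → ℝ) {U : Set (Fin n → ℝ)} (hU : U ∈ 𝓝 0) :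
    ∃ c > (0 : ℝ), Icc 0 (c • p) ⊆ U := by
  obtain ⟨ε, hε, hsub⟩ := Metric.mem_nhds_iff.1 hU
  have hev : ∀ᶠ c in 𝓝[>] (0 : ℝ), c • p ∈ Metric.ball (0 : Fin n → ℝ) ε := by
    have hc : Continuous fun c : ℝ => c • p := by fun_prop
    have : Tendsto (fun c : ℝ => c • p) (𝓝[>] 0) (𝓝 0) := by
      simpa using (hc.tendsto 0).mono_left nhdsWithin_le_nhds
    exact this (Metric.ball_mem_nhds _ hε)
  obtain ⟨c, hc, hpos⟩ := (hev.and self_mem_nhdsWithin).exists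
  refine ⟨c, hpos, fun x hx => hsub ?_⟩
  rw [mem_ball_zero_iff] at hc ⊢
  refine ((pi_norm_le_iff_of_nonneg (norm_nonneg _)).2 fun i => ?_).trans_lt hc
  refine le_trans ?_ (norm_le_pi_norm (c • p) i)
  rw [Real.norm_of_nonneg (hx.1 i), Real.norm_of_nonneg ((hx.1 i).trans (hx.2 i))]
  exact hx.2 i

/-- A cooperative system that decreases strictly in a positive direction is globally
asymptotically stable. -/
theorem isGloballyAsymptoticallyStable_of_fderiv_neg (hF : ContDiff ℝ 1 F) (h0 : F 0 = 0)
    (hM : ∀ x ∈ orthant n, IsMetzler (jacobian F x)) (hp : ∀ i, 0 < p i)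
    (hneg : ∀ x ∈ orthant n, ∀ i, fderiv ℝ F x p i < 0) :
    IsGloballyAsymptoticallyStable F (orthant n) 0 := by
  have hp0 : 0 ≤ p := fun i => (hp i).le
  have key : ∀ c : ℝ, 0 ≤ c → ∃ η > 0, ∀ x₀ ∈ Icc 0 (c • p),
      ∃ x, IsSolution F x₀ x ∧ ∀ t, 0 ≤ t → x t ∈ Icc 0 ((c * Real.exp (-η * t)) • p) := by
    intro c hc
    obtain ⟨η, hη0, hη⟩ := exists_rate hF hneg c
    exact ⟨η, hη0, fun x₀ hx₀ => exists_isSolution_decaying hF h0 hM hp0 hc hη0.le hη hx₀⟩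
  have key' : ∀ x₀ ∈ orthant n, ∃ c : ℝ, 0 ≤ c ∧ ∃ η > 0, ∃ x, IsSolution F x₀ x ∧
      ∀ t, 0 ≤ t → x t ∈ Icc 0 ((c * Real.exp (-η * t)) • p) := by
    intro x₀ hx₀
    obtain ⟨c, hc, hxc⟩ := exists_le_smul hp x₀
    obtain ⟨η, hη0, h⟩ := key c hc
    exact ⟨c, hc, η, hη0, h x₀ ⟨hx₀, hxc⟩⟩
  refine ⟨fun _ => le_rfl, h0, ?_, fun x₀ _ x y hx hy => hx.eqOn hF hy, ?_, ?_, ?_⟩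
  · intro x₀ hx₀
    obtain ⟨_, _, _, _, x, hx, _⟩ := key' x₀ hx₀
    exact ⟨x, hx⟩
  · intro x₀ hx₀ y hy t ht
    obtain ⟨_, _, _, _, x, hx, hbox⟩ := key' x₀ hx₀
    rw [hy.eqOn hF hx ht]
    exact (hbox t ht).1
  · intro U hU
    obtain ⟨c, hc, hsub⟩ := exists_Icc_smul_subset p hU
    obtain ⟨η, hη0, h⟩ := key c hc.le
    refine ⟨Set.pi univ fun i => Iio (c * p i), set_pi_mem_nhds finite_univ fun i _ =>
      Iio_mem_nhds (mul_pos hc (hp i)), fun x₀ hx₀ y hy t ht => ?_⟩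
    obtain ⟨x, hx, hbox⟩ := h x₀ ⟨hx₀.2, fun i => (hx₀.1 i (mem_univ i)).le⟩
    rw [hy.eqOn hF hx ht]
    refine hsub ⟨(hbox t ht).1, (hbox t ht).2.trans (smul_le_smul_of_nonneg_right ?_ hp0)⟩
    exact mul_le_of_le_one_right hc.le (Real.exp_le_one_iff.2 (by nlinarith))
  · intro x₀ hx₀ y hy
    obtain ⟨c, hc, η, hη0, x, hx, hbox⟩ := key' x₀ hx₀
    have hexp : Tendsto (fun t => (c * Real.exp (-η * t)) • p) atTop (𝓝 0) := by
      have h1 : Tendsto (fun t => Real.exp (-η * t)) atTop (𝓝 0) :=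
        Real.tendsto_exp_atBot.comp (tendsto_id.const_mul_atTop_of_neg (neg_neg_of_pos hη0))
      simpa using (h1.const_mul c).smul_const p
    have hy' : ∀ᶠ t in atTop, y t ∈ Icc 0 ((c * Real.exp (-η * t)) • p) := by
      filter_upwards [eventually_ge_atTop 0] with t ht
      rw [hy.eqOn hF hx ht]
      exact hbox t ht
    exact tendsto_pi_nhds.2 fun i => tendsto_of_tendsto_of_tendsto_of_le_of_le'
      tendsto_const_nhds (tendsto_pi_nhds.1 hexp i)
      (hy'.mono fun _ h => h.1 i) (hy'.mono fun _ h => h.2 i)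

end Cooperative

/-! ### The interconnected system -/

section Interconnection

variable {n : ℕ} {G : Digraph (Fin n)} {f : ∀ i : Fin n, ℝ × (nbrs G i → ℝ) → ℝ}

lemma mem_nbrs {i j : Fin n} : j ∈ nbrs G i ↔ G.Adj j i := by
  simp [nbrs]

lemma contDiff_field (hf : ∀ i, ContDiff ℝ 1 (f i)) : ContDiff ℝ 1 (field f) :=
  contDiff_pi.2 fun i => (hf i).comp (by fun_prop)

/-- Moving along the `j`-th axis changes no argument of `f i`. -/
lemma jacobian_field_eq_zero (hf : ∀ i, ContDiff ℝ 1 (f i)) (x : Fin n → ℝ) {i j : Fin n}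
    (hji : j ≠ i) (hj : j ∉ nbrs G i) : jacobian (field f) x i j = 0 := by
  have hd : HasFDerivAt (field f) (fderiv ℝ (field f) x) x :=
    ((contDiff_field hf).differentiable one_ne_zero x).hasFDerivAt
  have h1 := hasDerivAt_pi.1 (hd.hasLineDerivAt (Pi.single j 1)) i
  have hconst : (fun t : ℝ => field f (x + t • Pi.single j 1) i) = fun _ => field f x i := by
    funext t
    have hne : ∀ k, k ≠ j → (x + t • (Pi.single j 1 : Fin n → ℝ)) k = x k := fun k hk => by
      simp [hk]
    have h2 : (fun k : nbrs G i => (x + t • (Pi.single j 1 : Fin n → ℝ)) k) = fun k : nbrs G i => x k :=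
      funext fun k => hne k fun hk => hj (hk ▸ k.2)
    rw [field, field, h2, hne i hji.symm]
  rw [jacobian_apply]
  exact h1.unique (hconst ▸ hasDerivAt_const _ _)

/-- The weighted row sum condition makes the Jacobian negative on any potential of `ψ`. -/
lemma fderiv_field_neg (hG : ∀ i, ¬ G.Adj i i) (hf : ∀ i, ContDiff ℝ 1 (f i))
    {ψ : Fin n → Fin n → ℝ} (hψ : ∀ i, ∀ j ∈ nbrs G i, 0 < ψ i j) {x : Fin n → ℝ}
    (hM : IsMetzler (jacobian (field f) x)) {i : Fin n} (hdiag : jacobian (field f) x i i < 0)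
    (hsum : ∑ j ∈ nbrs G i, (jacobian (field f) x i j / (-jacobian (field f) x i i)) *
      (ψ i j)⁻¹ < 1) {p : Fin n → ℝ} (hp : ∀ i, 0 < p i)
    (hle : ∀ j ∈ nbrs G i, ψ i j * p j ≤ p i) : fderiv ℝ (field f) x p i < 0 := by
  set J := jacobian (field f) x
  have hi : i ∉ nbrs G i := fun h => hG i (mem_nbrs.1 h)
  have hne : ∀ j ∈ nbrs G i, i ≠ j := fun j hj h => hi (h ▸ hj)
  have h1 : fderiv ℝ (field f) x p i = J i i * p i + ∑ j ∈ nbrs G i, J i j * p j := by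
    rw [fderiv_apply_eq_sum, ← Finset.sum_insert (f := fun j => J i j * p j) hi]
    refine (Finset.sum_subset (Finset.subset_univ _) fun j _ hj => ?_).symm
    rw [Finset.mem_insert, not_or] at hj
    rw [jacobian_field_eq_zero hf x hj.1 hj.2, zero_mul]
  have h2 : ∑ j ∈ nbrs G i, J i j * p j ≤
      (-J i i * p i) * ∑ j ∈ nbrs G i, (J i j / (-J i i)) * (ψ i j)⁻¹ := by
    rw [Finset.mul_sum]
    refine Finset.sum_le_sum fun j hj => ?_
    have h3 : p j ≤ (ψ i j)⁻¹ * p i := (le_inv_mul_iff₀ (hψ i j hj)).2 (hle j hj)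
    calc J i j * p j ≤ J i j * ((ψ i j)⁻¹ * p i) :=
          mul_le_mul_of_nonneg_left h3 (hM i j (hne j hj))
      _ = _ := by field_simp [hdiag.ne]
  have h4 := mul_lt_mul_of_pos_left hsum (mul_pos (neg_pos.2 hdiag) (hp i))
  rw [h1]
  linarith

end Interconnection

end MonotoneNetwork

theorem mainTheorem3 (n : ℕ) (G : Digraph (Fin n)) (hG : ∀ i, ¬ G.Adj i i)
    (f : ∀ i : Fin n, ℝ × (MonotoneNetwork.nbrs G i → ℝ) → ℝ)
    (hf : ∀ i, ContDiff ℝ 1 (f i))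
    (hf0 : MonotoneNetwork.field f 0 = 0)
    (hMetzler : ∀ x ∈ MonotoneNetwork.orthant n,
      MonotoneNetwork.IsMetzler (MonotoneNetwork.jacobian (MonotoneNetwork.field f) x))
    (hdiag : ∀ x ∈ MonotoneNetwork.orthant n, ∀ i,
      MonotoneNetwork.jacobian (MonotoneNetwork.field f) x i i < 0)
    (ψ : Fin n → Fin n → ℝ)
    (hψ : ∀ i, ∀ j ∈ MonotoneNetwork.nbrs G i, 0 < ψ i j)
    (hsum : ∀ i, ∀ x ∈ MonotoneNetwork.orthant n,
      ∑ j ∈ MonotoneNetwork.nbrs G i,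
        (MonotoneNetwork.jacobian (MonotoneNetwork.field f) x i j /
          (-MonotoneNetwork.jacobian (MonotoneNetwork.field f) x i i)) * (ψ i j)⁻¹ < 1)
    (hcycle : ∀ c : MonotoneNetwork.SimpleCycle G, c.gain ψ < 1) :
    MonotoneNetwork.IsGloballyAsymptoticallyStable (MonotoneNetwork.field f)
      (MonotoneNetwork.orthant n) 0 := by
  have hψ' : ∀ i j, G.Adj j i → 0 < ψ i j := fun i j h =>
    hψ i j (MonotoneNetwork.mem_nbrs.2 h)
  exact MonotoneNetwork.isGloballyAsymptoticallyStable_of_fderiv_neg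
    (MonotoneNetwork.contDiff_field hf) hf0 hMetzler (MonotoneNetwork.potential_pos hψ')
    fun x hx i => MonotoneNetwork.fderiv_field_neg hG hf hψ (hMetzler x hx) (hdiag x hx i)
      (hsum i x hx) (MonotoneNetwork.potential_pos hψ') fun j hj =>
        MonotoneNetwork.mul_potential_le hG hψ' hcycle (MonotoneNetwork.mem_nbrs.1 hj)
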